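/- Let $r\in\mathbb N$ and let $(v_k)_{k\ge 1}$ be real numbers with $v_k=0$ for $k>r$. Put $d_j:=v_{|j|+1}$ for $j\in\mathbb Z$, let $\varepsilon(x):=\sum_{k\in\mathbb Z}d_kx^k$ for $|x|=1$ (a real number), let $\beta>0$, $f(x):=-\tanh(\beta x/2)$ and $\lambda:=f\circ\varepsilon$. For $N\in\mathbb N$ and $0\le k,l\le N-1$ let $$X^{(N)}_{k,l}:=\frac1N\sum_{j=0}^{N-1}\lambda(e^{2\pi i j/N})e^{-2\pi i j(k-l)/N},\qquad X_{k,l}:=\frac1{2\pi}\int_0^{2\pi}\lambda(e^{i\phi})e^{-i(k-l)\phi}\,d\phi .$$ Fix $q\in(0,1)$ and let $A:=\{0,\dots,\lceil qN\rceil-1\}$, $B:=\{\lceil qN\rceil,\dots,N-1\}$; $M|_S$ denotes the principal submatrix of $M$ with index set $S$. For $\alpha\ge 0$ and $x\in[-1,1]$ let $s_\alpha(x):=\frac1{1-\alpha}\log_2\bigl((\tfrac{1+x}2)^\alpha+(\tfrac{1-x}2)^\alpha\bigr)$ if $\alpha\ne1$ (with $0^0=1$), and $s_1(x):=-\tfrac{1+x}2\log_2\tfrac{1+x}2-\tfrac{1-x}2\log_2\tfrac{1-x}2$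 (with $0\log_2 0=0$). Let $$e_{A}(N):=\bigl|\operatorname{tr}s_\alpha(X^{(N)}|_A)-\operatorname{tr}s_\alpha(X|_A)\bigr|,\qquad e_{B}(N):=\bigl|\operatorname{tr}s_\alpha(X^{(N)}|_B)-\operatorname{tr}s_\alpha(X|_B)\bigr| .$$ Then: 1. There are constants $c_A,c_B>0$, depending only on $\beta$, $q$ and $\lambda$, such that for every $\alpha\ge0$, $\lim_{N\to\infty}e^{Nc_A}e_A(N)=0$ and $\lim_{N\to\infty}e^{Nc_B}e_B(N)=0$. 2. There is $\kappa>0$ such that $\phi\mapsto\lambda(e^{i\phi})$ extends to a bounded, holomorphic, $2\pi$-periodic function on the strip $\{z\in\mathbb C:|\operatorname{Im}z|<\kappa\}$. 3. Let $\kappa>0$ be any number as in 2 and let $\alpha\ge0$. If $s_\alpha$ is Hölder continuous on $[-1,1]$ with exponent $\gamma\in(0,1]$, then $\lim_{N\to\infty}e^{Nc}e_A(N)=0$ for every $c<\gamma\kappa(1-q)$ and $\lim_{N\to\infty}e^{Nc}e_B(N)=0$ for every $c<\gamma\kappa q$. Moreover, $\lim_{N\to\infty}e^{Nc}e_A(N)=0$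 for every $c<\min(\alpha,1)\,\kappa(1-q)$ and $\lim_{N\to\infty}e^{Nc}e_B(N)=0$ for every $c<\min(\alpha,1)\,\kappa q$; in particular, for $\alpha\ge1$ all rates $c<\kappa(1-q)$, respectively $c<\kappa q$, are admissible. -/

import Mathlib

open Filter Topology
open scoped NNReal

noncomputable section

/-- The couplings `d_j = v_{|j|+1}` (`j ∈ ℤ`) determined by a sequence `v_1, v_2, …`;
`v 0` is never used, `v 1` sits on the main diagonal of the Hamiltonian matrix. -/
def coupling (v : ℕ → ℝ) (j : ℤ) : ℝ := v (j.natAbs + 1)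

/-- The dispersion relation `ε(x) = ∑_{k ∈ ℤ} d_k x^k` on the unit circle. The sum is real there
because `d_{-k} = d_k`, so taking the real part loses nothing. -/
def dispersion (v : ℕ → ℝ) (x : Circle) : ℝ :=
  (∑' k : ℤ, (coupling v k : ℂ) * (x : ℂ) ^ k).re

/-- `f(x) = 2 e^{-βx} / (e^{-βx} + 1) - 1 = -tanh(βx/2)`. -/
def thermal (β x : ℝ) : ℝ := -Real.tanh (β * x / 2)

/-- The symbol `λ = f ∘ ε`. -/
def covSymbol (β : ℝ) (v : ℕ → ℝ) (x : Circle) : ℝ := thermal β (dispersion v x)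

/-- `x_k^{(N)} = (1/N) ∑_{j=0}^{N-1} λ(e^{2πij/N}) e^{-2πijk/N}`. -/
def finCoeff (β : ℝ) (v : ℕ → ℝ) (N : ℕ) (k : ℤ) : ℂ :=
  (1 / (N : ℂ)) * ∑ j ∈ Finset.range N,
    (covSymbol β v (Circle.exp (2 * Real.pi * j / N)) : ℂ) *
      Complex.exp (-(2 * Real.pi * Complex.I * j * k / N))

/-- `x_k = (1/2π) ∫_0^{2π} λ(e^{iφ}) e^{-ikφ} dφ`. -/
def infCoeff (β : ℝ) (v : ℕ → ℝ) (k : ℤ) : ℂ :=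
  (1 / (2 * Real.pi : ℂ)) * ∫ φ in (0 : ℝ)..(2 * Real.pi),
    (covSymbol β v (Circle.exp φ) : ℂ) * Complex.exp (-(Complex.I * k * φ))

/-- The circulant matrix `X^{(N)}` on the sites `0, …, N-1`. -/
def finX (β : ℝ) (v : ℕ → ℝ) (N : ℕ) : Matrix (Fin N) (Fin N) ℂ :=
  Matrix.of fun k l => finCoeff β v N ((k : ℤ) - (l : ℤ))

/-- The entries of the infinite Töplitz matrix `X` at the sites `0, …, N-1`. -/
def infX (β : ℝ) (v : ℕ → ℝ) (N : ℕ) : Matrix (Fin N) (Fin N) ℂ :=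
  Matrix.of fun k l => infCoeff β v ((k : ℤ) - (l : ℤ))

/-- `A = {0, …, ⌈qN⌉ - 1}`. -/
def regionA (q : ℝ) (N : ℕ) : Finset (Fin N) :=
  Finset.univ.filter fun i => (i : ℕ) < ⌈q * N⌉₊

/-- `B = {⌈qN⌉, …, N - 1}`. -/
def regionB (q : ℝ) (N : ℕ) : Finset (Fin N) :=
  Finset.univ.filter fun i => ⌈q * N⌉₊ ≤ (i : ℕ)

/-- The principal submatrix `M|_S`. -/
def principal {N : ℕ} (M : Matrix (Fin N) (Fin N) ℂ) (S : Finset (Fin N)) : Matrix S S ℂ :=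
  M.submatrix (fun i => (i : Fin N)) (fun i => (i : Fin N))

/-- The (covariance) Rényi entropy function `s_α`; the von Neumann entropy function for
`α = 1`. -/
def entropyFun (α x : ℝ) : ℝ :=
  if α = 1 then
    -((1 + x) / 2) * Real.logb 2 ((1 + x) / 2) - ((1 - x) / 2) * Real.logb 2 ((1 - x) / 2)
  else
    1 / (1 - α) * Real.logb 2 (((1 + x) / 2) ^ α + ((1 - x) / 2) ^ α)

/-- `e_{S,β}(N) = |tr s_α(X^{(N)}|_S) - tr s_α(X|_S)|`, the matrix functions being those of the
continuous functional calculus of Hermitian matrices. -/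
def entropyError (α β : ℝ) (v : ℕ → ℝ) (N : ℕ) (S : Finset (Fin N)) : ℝ :=
  ‖(cfc (entropyFun α) (principal (finX β v N) S)).trace -
    (cfc (entropyFun α) (principal (infX β v N) S)).trace‖

/-- The function `φ ↦ λ(e^{iφ})` extends to a bounded, holomorphic, `2π`-periodic function on
the strip `|Im z| < κ`. -/
def ExtendsToStrip (β : ℝ) (v : ℕ → ℝ) (κ : ℝ) : Prop :=
  ∃ g : ℂ → ℂ,
    DifferentiableOn ℂ g {z | |z.im| < κ} ∧
    (∀ z : ℂ, |z.im| < κ → g (z + 2 * Real.pi) = g z) ∧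
    (∃ M : ℝ, ∀ z : ℂ, |z.im| < κ → ‖g z‖ ≤ M) ∧
    ∀ φ : ℝ, g φ = (covSymbol β v (Circle.exp φ) : ℂ)

/-- The errors `e N` decay exponentially at rate `c`: `exp(N c) e(N) → 0` as `N → ∞`. -/
def DecaysAtRate (e : ℕ → ℝ) (c : ℝ) : Prop :=
  Tendsto (fun N : ℕ => Real.exp (N * c) * e N) atTop (𝓝 0)

end

/-! The symbol is continuous on the compact circle and `|tanh| < 1`, so `|λ| ≤ m` for some `m < 1`.
By Parseval, compressions of both matrices then have spectrum in `[-m, m]`. There `s_α` is smooth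
for every `α`, hence Lipschitz: its singularities at `±1` are never met, and the rate does not
depend on `α` or on a Hölder exponent.

It remains to compare entries. Moving the contour inside the strip gives `|x_k| ≤ M e^{-c|k|}` for
`c < κ`. Aliasing writes `x_k^{(N)} - x_k` as the sum of `x_n` over `n ≡ k` mod `N`, `n ≠ k`, so
`|n| ≥ N - |k|` and the difference is `O(e^{-c(N-|k|)})` (`exists_norm_finCoeff_sub_infCoeff_le`).
On a region of diameter at most `(1-ρ)N` this is `O(e^{-cρN})`. Passing to traces costs only a
factor `N⁴` (`norm_trace_cfc_sub_le`), absorbed by any loss in the rate. Region `A` has `ρ = 1-q`,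
region `B` has `ρ = q`. -/

/-! ### Perturbation of traces of functions of Hermitian matrices. -/

namespace Matrix.IsHermitian

variable {n : Type*} [Fintype n] [DecidableEq n] {A B : Matrix n n ℂ}

theorem trace_cfc (hA : A.IsHermitian) (f : ℝ → ℝ) :
    (cfc f A).trace = ((∑ i, f (hA.eigenvalues i) : ℝ) : ℂ) := by
  rw [hA.cfc_eq, IsHermitian.cfc, Unitary.conjStarAlgAut_apply, Matrix.trace_mul_comm,
    ← mul_assoc]
  simp [Matrix.trace]

/-- The eigenvalues of a Hermitian matrix lie in every symmetric interval that bounds its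
quadratic form. -/
theorem eigenvalues_mem_Icc_of_quadratic_form_le (hA : A.IsHermitian) {m : ℝ}
    (h : ∀ x : n → ℂ, ‖star x ⬝ᵥ (A *ᵥ x)‖ ≤ m * ∑ i, ‖x i‖ ^ 2) (i : n) :
    hA.eigenvalues i ∈ Set.Icc (-m) m := by
  have h1 : ∑ j, ‖(hA.eigenvectorBasis i : EuclideanSpace ℂ n) j‖ ^ 2 = 1 := by
    rw [← EuclideanSpace.norm_sq_eq, hA.eigenvectorBasis.orthonormal.1 i, one_pow]
  have h2 := h (hA.eigenvectorBasis i : EuclideanSpace ℂ n)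
  rw [h1, mul_one] at h2
  rw [Set.mem_Icc, ← abs_le, hA.eigenvalues_eq i]
  exact (RCLike.abs_re_le_norm _).trans h2

/-- With `U`, `W` the eigenvector matrices, the left side is the norm of an entry of `U* (A - B) W`.
That entry is a sum of `n²` terms, each at most `δ` because entries of unitaries have norm at most
1. -/
theorem norm_eigenvalues_sub_mul_le (hA : A.IsHermitian) (hB : B.IsHermitian) {δ : ℝ}
    (h : ∀ i j, ‖A i j - B i j‖ ≤ δ) (i j : n) :
    ‖((hA.eigenvalues i - hB.eigenvalues j : ℝ) : ℂ) *
      (star (hA.eigenvectorUnitary : Matrix n n ℂ) * (hB.eigenvectorUnitary : Matrix n n ℂ)) i j‖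
      ≤ (Fintype.card n : ℝ) ^ 2 * δ := by
  set U : Matrix n n ℂ := (hA.eigenvectorUnitary : Matrix n n ℂ) with hU
  set W : Matrix n n ℂ := (hB.eigenvectorUnitary : Matrix n n ℂ) with hW
  have hUU : star U * U = 1 := Unitary.coe_star_mul_self hA.eigenvectorUnitary
  have hWW : star W * W = 1 := Unitary.coe_star_mul_self hB.eigenvectorUnitary
  have hAU : star U * A = diagonal (RCLike.ofReal ∘ hA.eigenvalues) * star U := by
    conv_lhs => rw [hA.spectral_theorem, Unitary.conjStarAlgAut_apply]
    rw [← hU, ← mul_assoc, ← mul_assoc, hUU, one_mul]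
  have hBW : B * W = W * diagonal (RCLike.ofReal ∘ hB.eigenvalues) := by
    conv_lhs => rw [hB.spectral_theorem, Unitary.conjStarAlgAut_apply]
    rw [← hW, mul_assoc, hWW, mul_one]
  have key : ((hA.eigenvalues i - hB.eigenvalues j : ℝ) : ℂ) * (star U * W) i j
      = (star U * (A - B) * W) i j := by
    rw [mul_sub, sub_mul, hAU, mul_assoc (star U) B, hBW, mul_assoc, ← mul_assoc (star U) W,
      sub_apply, diagonal_mul, mul_diagonal]
    simp
    ring
  rw [key]
  simp only [mul_apply, Finset.sum_mul]
  have hb : ∀ k l, ‖star U i l * (A - B) l k * W k j‖ ≤ δ := by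
    intro k l
    have hδ : 0 ≤ δ := (norm_nonneg _).trans (h l k)
    have h1 : ‖star U i l‖ ≤ 1 := by
      rw [star_apply, norm_star]
      exact entry_norm_bound_of_unitary hA.eigenvectorUnitary.2 _ _
    have h2 : ‖W k j‖ ≤ 1 := entry_norm_bound_of_unitary hB.eigenvectorUnitary.2 _ _
    rw [norm_mul, norm_mul]
    calc _ ≤ 1 * δ * 1 := by
          gcongr
          exact h l k
      _ = δ := by ring
  calc _ ≤ ∑ _k : n, ∑ _l : n, δ :=
        norm_sum_le_of_le _ fun k _ => norm_sum_le_of_le _ fun l _ => hb k l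
    _ = _ := by simp; ring

/-- If `f` is `L`-Lipschitz on a set containing the spectra of two Hermitian matrices with
entrywise distance at most `δ`, then the traces of `f` differ by at most `L n⁴ δ`. -/
theorem norm_trace_cfc_sub_le (hA : A.IsHermitian) (hB : B.IsHermitian) {δ : ℝ}
    (h : ∀ i j, ‖A i j - B i j‖ ≤ δ) {f : ℝ → ℝ} {s : Set ℝ} {L : ℝ≥0}
    (hf : LipschitzOnWith L f s) (hAs : ∀ i, hA.eigenvalues i ∈ s)
    (hBs : ∀ i, hB.eigenvalues i ∈ s) :
    ‖(cfc f A).trace - (cfc f B).trace‖ ≤ L * (Fintype.card n : ℝ) ^ 4 * δ := by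
  set V : Matrix n n ℂ :=
    star (hA.eigenvectorUnitary : Matrix n n ℂ) * (hB.eigenvectorUnitary : Matrix n n ℂ) with hV
  have hVu : V ∈ unitaryGroup n ℂ :=
    mul_mem (Unitary.star_mem hA.eigenvectorUnitary.2) hB.eigenvectorUnitary.2
  have hrow : ∀ i, ∑ j, ‖V i j‖ ^ 2 = 1 := by
    intro i
    have := congrFun (congrFun (mem_unitaryGroup_iff.1 hVu) i) i
    simp only [mul_apply, star_apply, one_apply_eq] at this
    have h2 : ((∑ j, ‖V i j‖ ^ 2 : ℝ) : ℂ) = 1 := by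
      rw [← this]
      push_cast
      exact Finset.sum_congr rfl fun j _ => (Complex.mul_conj' _).symm
    exact_mod_cast h2
  have hcol : ∀ j, ∑ i, ‖V i j‖ ^ 2 = 1 := by
    intro j
    have := congrFun (congrFun (mem_unitaryGroup_iff'.1 hVu) j) j
    simp only [mul_apply, star_apply, one_apply_eq] at this
    have h2 : ((∑ i, ‖V i j‖ ^ 2 : ℝ) : ℂ) = 1 := by
      rw [← this]
      push_cast
      exact Finset.sum_congr rfl fun i _ => (Complex.conj_mul' _).symm
    exact_mod_cast h2
  -- The weights `|V i j|²` are doubly stochastic, so the spectra can be compared without pairing up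
  -- eigenvalues.
  have hsum : ∑ i, f (hA.eigenvalues i) - ∑ j, f (hB.eigenvalues j)
      = ∑ i, ∑ j, (f (hA.eigenvalues i) - f (hB.eigenvalues j)) * ‖V i j‖ ^ 2 := by
    simp only [sub_mul, Finset.sum_sub_distrib]
    congr 1
    · simp only [← Finset.mul_sum, hrow, mul_one]
    · rw [Finset.sum_comm]
      simp only [← Finset.mul_sum, hcol, mul_one]
  rw [hA.trace_cfc, hB.trace_cfc, ← Complex.ofReal_sub, Complex.norm_real, hsum]
  have hterm : ∀ i j, ‖(f (hA.eigenvalues i) - f (hB.eigenvalues j)) * ‖V i j‖ ^ 2‖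
      ≤ L * ((Fintype.card n : ℝ) ^ 2 * δ) := by
    intro i j
    have h1 : ‖f (hA.eigenvalues i) - f (hB.eigenvalues j)‖
        ≤ L * ‖hA.eigenvalues i - hB.eigenvalues j‖ := by
      simpa [dist_eq_norm] using hf.dist_le_mul _ (hAs i) _ (hBs j)
    have h2 : ‖V i j‖ ≤ 1 := entry_norm_bound_of_unitary hVu _ _
    have h3 := norm_eigenvalues_sub_mul_le hA hB h i j
    rw [norm_mul, Complex.norm_real, ← hV] at h3
    rw [norm_mul, norm_pow, norm_norm]
    -- One factor `|V i j| ≤ 1` is discarded; the other is needed for `norm_eigenvalues_sub_mul_le`.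
    calc _ ≤ (L * ‖hA.eigenvalues i - hB.eigenvalues j‖) * ‖V i j‖ := by
          gcongr
          rw [sq]
          exact mul_le_of_le_one_right (norm_nonneg _) h2
      _ ≤ _ := by
          rw [mul_assoc]
          gcongr
  calc _ ≤ ∑ _i : n, ∑ _j : n, L * ((Fintype.card n : ℝ) ^ 2 * δ) :=
        norm_sum_le_of_le _ fun i _ => norm_sum_le_of_le _ fun j _ => hterm i j
    _ = _ := by simp; ring

end Matrix.IsHermitian

/-! ### The symbol: bound away from `±1` and analytic extension. -/

theorem dispersion_eq_sum {v : ℕ → ℝ} {r : ℕ} (hv : ∀ k, r < k → v k = 0) (x : Circle) :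
    dispersion v x =
      (∑ k ∈ Finset.Icc (-(r : ℤ)) r, (coupling v k : ℂ) * (x : ℂ) ^ k).re := by
  rw [dispersion, tsum_eq_sum]
  intro k hk
  have : coupling v k = 0 := by
    apply hv
    rw [Finset.mem_Icc] at hk
    omega
  simp [this]

theorem continuous_dispersion {v : ℕ → ℝ} {r : ℕ} (hv : ∀ k, r < k → v k = 0) :
    Continuous (dispersion v) := by
  rw [funext (dispersion_eq_sum hv)]
  refine Complex.continuous_re.comp (continuous_finsetSum _ fun k _ => continuous_const.mul ?_)
  exact Continuous.zpow₀ (by fun_prop) k fun x => Or.inl x.coe_ne_zero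

theorem continuous_covSymbol (β : ℝ) {v : ℕ → ℝ} {r : ℕ} (hv : ∀ k, r < k → v k = 0) :
    Continuous (covSymbol β v) := by
  have := continuous_dispersion hv
  unfold covSymbol thermal
  simp only [Real.tanh_eq_sinh_div_cosh]
  exact ((Real.continuous_sinh.comp (by fun_prop)).div (Real.continuous_cosh.comp (by fun_prop))
    fun x => (Real.cosh_pos _).ne').neg

theorem exists_abs_covSymbol_le (β : ℝ) {v : ℕ → ℝ} {r : ℕ} (hv : ∀ k, r < k → v k = 0) :
    ∃ m : ℝ, 0 ≤ m ∧ m < 1 ∧ ∀ x, |covSymbol β v x| ≤ m := by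
  obtain ⟨x₀, -, hx₀⟩ := isCompact_univ.exists_isMaxOn Set.univ_nonempty
    (continuous_covSymbol β hv).abs.continuousOn
  refine ⟨|covSymbol β v x₀|, abs_nonneg _, ?_, fun x => hx₀ (Set.mem_univ x)⟩
  rw [covSymbol, thermal, abs_neg]
  exact Real.abs_tanh_lt_one _

/-- The entire extension of `φ ↦ ε(e^{iφ})` for couplings of range less than `r`. -/
noncomputable def dispersionExt (v : ℕ → ℝ) (r : ℕ) (z : ℂ) : ℂ :=
  ∑ k ∈ Finset.Icc (-(r : ℤ)) r, (coupling v k : ℂ) * Complex.exp (Complex.I * k * z)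

/-- Conjugation swaps the terms `k` and `-k`, and `d_{-k} = d_k`. -/
theorem conj_dispersionExt_ofReal (v : ℕ → ℝ) (r : ℕ) (φ : ℝ) :
    (starRingEnd ℂ) (dispersionExt v r φ) = dispersionExt v r φ := by
  unfold dispersionExt
  rw [map_sum]
  refine Finset.sum_equiv (Equiv.neg ℤ) (fun k => ?_) fun k _ => ?_
  · simp only [Finset.mem_Icc, Equiv.neg_apply]
    omega
  · rw [map_mul, Complex.conj_ofReal, ← Complex.exp_conj]
    simp [coupling]

theorem dispersionExt_ofReal {v : ℕ → ℝ} {r : ℕ} (hv : ∀ k, r < k → v k = 0) (φ : ℝ) :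
    dispersionExt v r φ = (dispersion v (Circle.exp φ) : ℂ) := by
  rw [← Complex.conj_eq_iff_re.1 (conj_dispersionExt_ofReal v r φ), dispersion_eq_sum hv,
    dispersionExt]
  simp only [Circle.coe_exp, ← Complex.exp_int_mul]
  congr 3
  ext k
  ring_nf

theorem thermal_eq (β x : ℝ) : thermal β x = 2 / (Real.exp (β * x) + 1) - 1 := by
  have h : Real.exp (β * x) = Real.exp (β * x / 2) ^ 2 := by
    rw [← Real.exp_nat_mul]
    congr 1
    push_cast
    ring
  rw [thermal, Real.tanh_eq, h, Real.exp_neg]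
  have := Real.exp_pos (β * x / 2)
  field_simp
  ring

/-- The extension is real on the real axis, so its imaginary part at `z` is bounded by its distance
to the value at `z.re`. That distance has a bound depending only on `z.im`, continuous and zero at
0. -/
theorem exists_abs_im_dispersionExt_le (v : ℕ → ℝ) (r : ℕ) {c : ℝ} (hc : 0 < c) :
    ∃ κ : ℝ, 0 < κ ∧ ∀ z : ℂ, |z.im| < κ → |(dispersionExt v r z).im| ≤ c := by
  have hcont : Continuous fun y : ℝ => ∑ k ∈ Finset.Icc (-(r : ℤ)) r,
      |coupling v k| * |Real.exp (-(k * y)) - 1| := by fun_prop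
  have h0 := hcont.tendsto 0
  simp only [mul_zero, neg_zero, Real.exp_zero, sub_self, abs_zero, Finset.sum_const_zero] at h0
  obtain ⟨κ, hκ, h⟩ := Metric.eventually_nhds_iff.1 (h0.eventually (ge_mem_nhds hc))
  refine ⟨κ, hκ, fun z hz => ?_⟩
  have hre : (dispersionExt v r (z.re : ℂ)).im = 0 :=
    Complex.conj_eq_iff_im.1 (conj_dispersionExt_ofReal v r z.re)
  have hsub : (dispersionExt v r z).im = (dispersionExt v r z - dispersionExt v r z.re).im := by
    simp [hre]
  rw [hsub]
  refine (Complex.abs_im_le_norm _).trans (le_trans ?_ (h (y := z.im) (by simpa using hz)))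
  rw [dispersionExt, dispersionExt, ← Finset.sum_sub_distrib]
  refine norm_sum_le_of_le _ fun k _ => le_of_eq ?_
  have hz' : Complex.I * k * z = Complex.I * k * z.re + ((-(k * z.im) : ℝ) : ℂ) := by
    conv_lhs => rw [← Complex.re_add_im z]
    push_cast
    linear_combination (k * z.im : ℂ) * Complex.I_sq
  have hn : ‖Complex.exp (Complex.I * k * z.re)‖ = 1 := by
    simp [Complex.norm_exp]
  rw [hz', Complex.exp_add, ← mul_sub, ← mul_sub_one, norm_mul, norm_mul, hn, one_mul,
    Complex.norm_real, ← Complex.ofReal_exp, ← Complex.ofReal_one, ← Complex.ofReal_sub,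
    Complex.norm_real, Real.norm_eq_abs, Real.norm_eq_abs]

theorem exists_extendsToStrip {β : ℝ} (hβ : 0 < β) {v : ℕ → ℝ} {r : ℕ}
    (hv : ∀ k, r < k → v k = 0) : ∃ κ : ℝ, 0 < κ ∧ ExtendsToStrip β v κ := by
  -- With `|Im βε| ≤ π/2` the real part of `e^{βε}` is nonnegative, so the denominator of
  -- `thermal_eq` has norm at least 1. This gives holomorphy and the bound 3 at once.
  obtain ⟨κ, hκ, h⟩ := exists_abs_im_dispersionExt_le v r
    (c := Real.pi / 2 / β) (by positivity)
  have hre : ∀ z : ℂ, |z.im| < κ → 1 ≤ (Complex.exp (β * dispersionExt v r z) + 1).re := by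
    intro z hz
    rw [Complex.add_re, Complex.exp_re, Complex.one_re, le_add_iff_nonneg_left,
      Complex.im_ofReal_mul]
    refine mul_nonneg (Real.exp_pos _).le (Real.cos_nonneg_of_mem_Icc ?_)
    rw [Set.mem_Icc, ← abs_le, abs_mul, abs_of_pos hβ]
    have := h z hz
    rwa [le_div_iff₀' hβ] at this
  have hdiff : Differentiable ℂ (dispersionExt v r) := by
    unfold dispersionExt
    fun_prop
  refine ⟨κ, hκ, fun z => 2 / (Complex.exp (β * dispersionExt v r z) + 1) - 1, ?_, ?_,
    ⟨3, ?_⟩, ?_⟩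
  · intro z hz
    refine DifferentiableAt.differentiableWithinAt ?_
    refine ((differentiableAt_const _).div (by fun_prop) fun h0 => ?_).sub_const _
    have := hre z hz
    rw [h0, Complex.zero_re] at this
    linarith
  · intro z _
    have : dispersionExt v r (z + 2 * Real.pi) = dispersionExt v r z := by
      refine Finset.sum_congr rfl fun k _ => ?_
      rw [show Complex.I * k * (z + 2 * Real.pi)
        = Complex.I * k * z + k * (2 * Real.pi * Complex.I) by ring, Complex.exp_add,
        Complex.exp_int_mul_two_pi_mul_I, mul_one]
    simp only [this]
  · intro z hz
    have h1 : 1 ≤ ‖Complex.exp (β * dispersionExt v r z) + 1‖ :=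
      (hre z hz).trans (Complex.re_le_norm _)
    calc _ ≤ ‖2 / (Complex.exp (β * dispersionExt v r z) + 1)‖ + ‖(1 : ℂ)‖ := norm_sub_le _ _
      _ ≤ 2 + 1 := by
        rw [norm_div, norm_one, Complex.norm_ofNat]
        gcongr
        exact div_le_self zero_le_two h1
      _ = 3 := by norm_num
  · intro φ
    simp only [dispersionExt_ofReal hv, covSymbol, thermal_eq]
    push_cast
    rfl

/-! ### Exponential decay of the Fourier coefficients. -/

/-- Integrals over a period of a holomorphic periodic function on a horizontal strip do not change
when the line of integration is moved inside the strip. -/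
theorem integral_period_eq_of_abs_lt {h : ℂ → ℂ} {κ T τ : ℝ}
    (hd : DifferentiableOn ℂ h {z | |z.im| < κ})
    (hp : ∀ z : ℂ, |z.im| < κ → h (z + T) = h z) (hτ : |τ| < κ) :
    ∫ x in (0 : ℝ)..T, h x = ∫ x in (0 : ℝ)..T, h (x + τ * Complex.I) := by
  have hsub : ∀ y ∈ Set.uIcc 0 τ, |y| < κ := fun y hy =>
    lt_of_le_of_lt (by simpa using Set.abs_sub_left_of_mem_uIcc hy) hτ
  have := Complex.integral_boundary_rect_eq_zero_of_differentiableOn h 0 (T + τ * Complex.I)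
    (hd.mono fun z hz => hsub _ (by simpa using hz.2))
  simp only [Complex.zero_re, Complex.zero_im, Complex.add_re, Complex.ofReal_re, Complex.mul_re,
    Complex.I_re, mul_zero, Complex.ofReal_im, Complex.I_im, mul_one, sub_self, add_zero,
    Complex.add_im, Complex.mul_im, zero_add, Complex.ofReal_zero, zero_mul] at this
  have hside : ∫ y in (0 : ℝ)..τ, h (T + y * Complex.I) = ∫ y in (0 : ℝ)..τ, h (y * Complex.I) := by
    refine intervalIntegral.integral_congr fun y hy => ?_
    rw [add_comm]
    exact hp _ (by simpa using hsub y hy)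
  rw [hside, add_sub_cancel_right] at this
  exact sub_eq_zero.1 this

/-- On the shifted line `Im z = τ` one has `|e^{-ikz}| = e^{kτ}`, while the extension stays bounded
by the same `M` for all `τ`. -/
theorem exists_norm_infCoeff_le {β : ℝ} {v : ℕ → ℝ} {κ : ℝ} (hκ : 0 < κ)
    (hext : ExtendsToStrip β v κ) :
    ∃ M : ℝ, 0 ≤ M ∧ ∀ τ : ℝ, |τ| < κ → ∀ k : ℤ,
      ‖infCoeff β v k‖ ≤ M * Real.exp (k * τ) := by
  obtain ⟨g, hd, hp, ⟨M, hM⟩, hg⟩ := hext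
  have hM0 : 0 ≤ M := (norm_nonneg _).trans (hM 0 (by simpa using hκ))
  refine ⟨M, hM0, fun τ hτ k => ?_⟩
  have hshift := integral_period_eq_of_abs_lt (T := 2 * Real.pi) (τ := τ)
    (h := fun z => g z * Complex.exp (-(Complex.I * k * z))) (κ := κ)
    (hd.mul (by fun_prop)) (fun z hz => by
      have : Complex.exp (-(Complex.I * k * (z + 2 * Real.pi)))
          = Complex.exp (-(Complex.I * k * z)) := by
        rw [show -(Complex.I * k * (z + 2 * Real.pi))
          = -(Complex.I * k * z) + ((-k : ℤ) : ℂ) * (2 * Real.pi * Complex.I) by push_cast; ring,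
          Complex.exp_add, Complex.exp_int_mul_two_pi_mul_I, mul_one]
      push_cast
      rw [hp z hz, this]) hτ
  simp only [hg] at hshift
  rw [infCoeff, hshift, norm_mul]
  have hb : ‖∫ x in (0 : ℝ)..(2 * Real.pi), g (x + τ * Complex.I) *
      Complex.exp (-(Complex.I * k * (x + τ * Complex.I)))‖
      ≤ M * Real.exp (k * τ) * |2 * Real.pi - 0| := by
    refine intervalIntegral.norm_integral_le_of_norm_le_const fun x _ => ?_
    rw [norm_mul]
    refine mul_le_mul (hM _ (by simpa using hτ)) (le_of_eq ?_) (norm_nonneg _) hM0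
    rw [Complex.norm_exp]
    simp
  rw [sub_zero, abs_of_pos Real.two_pi_pos] at hb
  have hn : ‖(1 / (2 * Real.pi : ℂ))‖ = 1 / (2 * Real.pi) := by
    rw [norm_div, norm_one, norm_mul, Complex.norm_ofNat, Complex.norm_real,
      Real.norm_of_nonneg Real.pi_pos.le]
  rw [hn, one_div, inv_mul_le_iff₀ Real.two_pi_pos]
  linarith

theorem exists_norm_infCoeff_le_exp_neg_abs {β : ℝ} {v : ℕ → ℝ} {κ : ℝ} (hκ : 0 < κ)
    (hext : ExtendsToStrip β v κ) :
    ∃ M : ℝ, 0 ≤ M ∧ ∀ c : ℝ, 0 ≤ c → c < κ → ∀ k : ℤ,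
      ‖infCoeff β v k‖ ≤ M * Real.exp (-(c * |(k : ℝ)|)) := by
  obtain ⟨M, hM0, hM⟩ := exists_norm_infCoeff_le hκ hext
  refine ⟨M, hM0, fun c hc hcκ k => ?_⟩
  rcases le_total (0 : ℝ) k with hk | hk
  · convert hM (-c) (by rwa [abs_neg, abs_of_nonneg hc]) k using 3
    rw [abs_of_nonneg hk]
    ring
  · convert hM c (by rwa [abs_of_nonneg hc]) k using 3
    rw [abs_of_nonpos hk]
    ring

theorem summable_exp_neg_mul_abs_int {c : ℝ} (hc : 0 < c) :
    Summable fun k : ℤ => Real.exp (-(c * |(k : ℝ)|)) := by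
  have h : Summable fun k : ℕ => Real.exp (-(c * (k : ℝ))) := by
    have := Real.summable_exp_nat_mul_iff.2 (neg_lt_zero.2 hc)
    refine this.congr fun k => ?_
    congr 1
    ring
  exact Summable.of_nat_of_neg (by simpa using h) (by simpa using h)

/-! ### Fourier inversion and aliasing. -/

theorem hasSum_infCoeff_mul_exp {β : ℝ} {v : ℕ → ℝ} (hcont : Continuous (covSymbol β v))
    (hs : Summable (infCoeff β v)) (φ : ℝ) :
    HasSum (fun n : ℤ => infCoeff β v n * Complex.exp (Complex.I * n * φ))
      (covSymbol β v (Circle.exp φ) : ℂ) := by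
  have : Fact (0 < 2 * Real.pi) := ⟨Real.two_pi_pos⟩
  let F : C(AddCircle (2 * Real.pi), ℂ) :=
    ⟨fun t => (covSymbol β v t.toCircle : ℂ),
      Complex.continuous_ofReal.comp (hcont.comp AddCircle.continuous_toCircle)⟩
  have hF : ∀ x : ℝ, F (x : AddCircle (2 * Real.pi)) = (covSymbol β v (Circle.exp x) : ℂ) := by
    intro x
    simp only [F, ContinuousMap.coe_mk, AddCircle.toCircle_apply_mk]
    rw [div_self Real.two_pi_pos.ne', one_mul]
  have hfourier : ∀ (n : ℤ) (x : ℝ), fourier n (x : AddCircle (2 * Real.pi))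
      = Complex.exp (Complex.I * n * x) := by
    intro n x
    rw [fourier_coe_apply]
    congr 1
    have : (Real.pi : ℂ) ≠ 0 := Complex.ofReal_ne_zero.2 Real.pi_ne_zero
    push_cast
    field_simp
  have hcoeff : fourierCoeff F = infCoeff β v := by
    ext n
    rw [fourierCoeff_eq_intervalIntegral _ _ 0, infCoeff, zero_add, Complex.real_smul]
    push_cast
    congr 1
    refine intervalIntegral.integral_congr fun x _ => ?_
    simp only [hF, hfourier, smul_eq_mul]
    rw [mul_comm]
    push_cast
    ring_nf
  have := has_pointwise_sum_fourier_series_of_summable (f := F) (hcoeff ▸ hs) φ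
  simpa only [hcoeff, hfourier, hF, smul_eq_mul] using this

theorem inv_mul_sum_exp_eq_ite {N : ℕ} (hN : N ≠ 0) (n : ℤ) :
    (1 / (N : ℂ)) * ∑ j ∈ Finset.range N, Complex.exp (2 * Real.pi * Complex.I * j * n / N) =
      if (N : ℤ) ∣ n then 1 else 0 := by
  have hN' : (N : ℂ) ≠ 0 := Nat.cast_ne_zero.2 hN
  have hpow : ∀ j : ℕ, Complex.exp (2 * Real.pi * Complex.I * j * n / N)
      = Complex.exp (2 * Real.pi * Complex.I * n / N) ^ j := by
    intro j
    rw [← Complex.exp_nat_mul]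
    congr 1
    ring
  simp only [hpow]
  split_ifs with h
  · obtain ⟨l, rfl⟩ := h
    have : Complex.exp (2 * Real.pi * Complex.I * ((N * l : ℤ) : ℂ) / N) = 1 := by
      rw [Complex.exp_eq_one_iff]
      refine ⟨l, ?_⟩
      push_cast
      field_simp
    simp only [this, one_pow, Finset.sum_const, Finset.card_range, nsmul_eq_mul, mul_one]
    exact one_div_mul_cancel hN'
  · have h1 : Complex.exp (2 * Real.pi * Complex.I * n / N) ≠ 1 := by
      rw [Ne, Complex.exp_eq_one_iff]
      rintro ⟨l, hl⟩
      apply h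
      refine ⟨l, ?_⟩
      have hpi : (2 * Real.pi * Complex.I : ℂ) ≠ 0 := Complex.two_pi_I_ne_zero
      rw [div_eq_iff hN'] at hl
      have : (n : ℂ) = N * l := mul_left_cancel₀ hpi (by linear_combination hl)
      exact_mod_cast this
    have hN1 : Complex.exp (2 * Real.pi * Complex.I * n / N) ^ N = 1 := by
      rw [← Complex.exp_nat_mul, Complex.exp_eq_one_iff]
      refine ⟨n, ?_⟩
      field_simp
    rw [geom_sum_eq h1, hN1, sub_self, zero_div, mul_zero]

/-- Aliasing: the discrete Fourier coefficients are the periodizations of the continuous ones. -/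
theorem hasSum_finCoeff {β : ℝ} {v : ℕ → ℝ} (hcont : Continuous (covSymbol β v))
    (hs : Summable (infCoeff β v)) {N : ℕ} (hN : N ≠ 0) (k : ℤ) :
    HasSum (fun n : ℤ => infCoeff β v n * if (N : ℤ) ∣ n - k then 1 else 0)
      (finCoeff β v N k) := by
  have hj : ∀ j ∈ Finset.range N, HasSum (fun n : ℤ => infCoeff β v n *
      Complex.exp (2 * Real.pi * Complex.I * j * ((n - k : ℤ) : ℂ) / N))
      ((covSymbol β v (Circle.exp (2 * Real.pi * j / N)) : ℂ) *
        Complex.exp (-(2 * Real.pi * Complex.I * j * k / N))) := by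
    intro j _
    refine ((hasSum_infCoeff_mul_exp hcont hs
      (2 * Real.pi * j / N)).mul_right (Complex.exp (-(2 * Real.pi * Complex.I * j * k / N)))).congr_fun
      fun n => ?_
    rw [mul_assoc (infCoeff β v n), ← Complex.exp_add]
    congr 2
    push_cast
    ring
  refine ((hasSum_sum hj).mul_left (1 / (N : ℂ))).congr_fun fun n => ?_
  rw [← Finset.mul_sum, ← inv_mul_sum_exp_eq_ite hN]
  ring

theorem exists_norm_finCoeff_sub_infCoeff_le {β : ℝ} {v : ℕ → ℝ} {κ : ℝ}
    (hcont : Continuous (covSymbol β v)) (hκ : 0 < κ) (hext : ExtendsToStrip β v κ) {c : ℝ}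
    (hc : 0 ≤ c) (hcκ : c < κ) :
    ∃ C : ℝ, 0 ≤ C ∧ ∀ N : ℕ, N ≠ 0 → ∀ k : ℤ,
      ‖finCoeff β v N k - infCoeff β v k‖ ≤ C * Real.exp (-(c * (N - |(k : ℝ)|))) := by
  obtain ⟨M, hM0, hM⟩ := exists_norm_infCoeff_le_exp_neg_abs hκ hext
  -- Splitting `e^{-c'|n|} = e^{-(c'-c)|n|} e^{-c|n|}`, the first factor is summable and yields `C`
  -- independent of `N` and `k`; the second yields the rate.
  obtain ⟨c', hcc', hc'⟩ := exists_between hcκ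
  have hMc := hM c' (hc.trans hcc'.le) hc'
  have hs : Summable (infCoeff β v) := Summable.of_norm_bounded
    ((summable_exp_neg_mul_abs_int (hc.trans_lt hcc')).mul_left M) hMc
  have hS := summable_exp_neg_mul_abs_int (sub_pos.2 hcc')
  refine ⟨M * ∑' n : ℤ, Real.exp (-((c' - c) * |(n : ℝ)|)),
    mul_nonneg hM0 (tsum_nonneg fun n => (Real.exp_pos _).le), fun N hN k => ?_⟩
  refine ((hasSum_finCoeff hcont hs hN k).sub
    (hasSum_ite_eq k (infCoeff β v k))).norm_le_of_bounded
    ((hS.hasSum.mul_left M).mul_right _) fun n => ?_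
  rcases eq_or_ne n k with rfl | hnk
  · simp only [sub_self, dvd_zero, if_true, mul_one, norm_zero]
    positivity
  rw [if_neg hnk, sub_zero]
  split_ifs with hdvd
  · have hNn : (N : ℝ) - |(k : ℝ)| ≤ |(n : ℝ)| := by
      have h1 : (N : ℤ) ≤ |n - k| :=
        Int.le_of_dvd (abs_pos.2 (sub_ne_zero.2 hnk)) ((dvd_abs _ _).2 hdvd)
      have h2 : (N : ℝ) ≤ |(n : ℝ) - k| := by exact_mod_cast h1
      linarith [abs_sub (n : ℝ) k]
    rw [mul_one]
    refine (hMc n).trans ?_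
    rw [mul_assoc, ← Real.exp_add]
    gcongr
    nlinarith
  · rw [mul_zero, norm_zero]
    positivity

/-! ### Spectral bounds from the symbol, and Hermitian symmetry. -/

section QuadraticForm

open scoped Matrix

variable {ι : Type*} [Fintype ι]

/-- The Hermitian form of a compressed circulant matrix with symbol values `w`, diagonalized by
the discrete Fourier transform. -/
theorem star_dotProduct_circulant_mulVec (w : ℕ → ℝ) (N : ℕ) (p : ι → ℤ) (x : ι → ℂ) :
    star x ⬝ᵥ (Matrix.of (fun i j => (1 / (N : ℂ)) * ∑ t ∈ Finset.range N, (w t : ℂ) *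
      Complex.exp (-(2 * Real.pi * Complex.I * t * ((p i - p j : ℤ) : ℂ) / N))) *ᵥ x) =
    (((1 / N) * ∑ t ∈ Finset.range N,
      w t * ‖∑ i, x i * Complex.exp (2 * Real.pi * Complex.I * t * p i / N)‖ ^ 2 : ℝ) : ℂ) := by
  push_cast
  simp only [← Complex.conj_mul', map_sum, map_mul, ← Complex.exp_conj, dotProduct,
    Matrix.mulVec, Matrix.of_apply, Finset.mul_sum, Finset.sum_mul, Pi.star_apply]
  rw [Finset.sum_comm_cycle]
  refine Finset.sum_congr rfl fun t _ => ?_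
  rw [Finset.sum_comm]
  refine Finset.sum_congr rfl fun i _ => Finset.sum_congr rfl fun j _ => ?_
  have : Complex.exp (-(2 * Real.pi * Complex.I * t * ((p j : ℂ) - p i) / N))
      = Complex.exp ((starRingEnd ℂ) (2 * Real.pi * Complex.I * t * p j / N)) *
        Complex.exp (2 * Real.pi * Complex.I * t * p i / N) := by
    rw [← Complex.exp_add]
    congr 1
    simp only [map_div₀, map_mul, Complex.conj_I, Complex.conj_ofReal, map_ofNat, map_natCast,
      map_intCast]
    ring
  rw [this, starRingEnd_apply, starRingEnd_apply]
  ring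

/-- Parseval: for the constant symbol 1 and sites distinct mod `N`, the compressed circulant is the
identity. -/
theorem inv_mul_sum_norm_sq_exp {N : ℕ} (hN : N ≠ 0) {p : ι → ℤ}
    (hp : ∀ i j, (N : ℤ) ∣ p i - p j → i = j) (x : ι → ℂ) :
    (1 / N : ℝ) * ∑ t ∈ Finset.range N,
      ‖∑ i, x i * Complex.exp (2 * Real.pi * Complex.I * t * p i / N)‖ ^ 2 = ∑ i, ‖x i‖ ^ 2 := by
  classical
  have h := star_dotProduct_circulant_mulVec (fun _ => 1) N p x
  have h1 : (Matrix.of (fun i j => (1 / (N : ℂ)) * ∑ t ∈ Finset.range N, ((1 : ℝ) : ℂ) *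
      Complex.exp (-(2 * Real.pi * Complex.I * t * ((p i - p j : ℤ) : ℂ) / N)))) = 1 := by
    ext i j
    have := inv_mul_sum_exp_eq_ite hN (p j - p i)
    rw [Matrix.of_apply, Matrix.one_apply]
    convert this using 3 with t
    · rw [Complex.ofReal_one, one_mul]
      congr 1
      push_cast
      ring
    · exact ⟨fun hij => by simp [hij], fun hd => (hp j i hd).symm⟩
  rw [h1, Matrix.one_mulVec] at h
  simp only [one_mul] at h
  have h2 : star x ⬝ᵥ x = ((∑ i, ‖x i‖ ^ 2 : ℝ) : ℂ) := by
    push_cast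
    exact Finset.sum_congr rfl fun i _ => Complex.conj_mul' _
  rw [h2] at h
  exact_mod_cast h.symm

variable {β : ℝ} {v : ℕ → ℝ} {m : ℝ}

theorem norm_quadratic_form_finCoeff_le (hm : ∀ x, |covSymbol β v x| ≤ m) {N : ℕ} (hN : N ≠ 0)
    {p : ι → ℤ} (hp : ∀ i j, (N : ℤ) ∣ p i - p j → i = j) (x : ι → ℂ) :
    ‖star x ⬝ᵥ (Matrix.of (fun i j => finCoeff β v N (p i - p j)) *ᵥ x)‖
      ≤ m * ∑ i, ‖x i‖ ^ 2 := by
  have h := star_dotProduct_circulant_mulVec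
    (fun t => covSymbol β v (Circle.exp (2 * Real.pi * t / N))) N p x
  unfold finCoeff
  rw [h, Complex.norm_real, ← inv_mul_sum_norm_sq_exp hN hp x, norm_mul,
    Real.norm_of_nonneg (by positivity : (0 : ℝ) ≤ 1 / N), mul_left_comm m, Finset.mul_sum]
  gcongr
  refine norm_sum_le_of_le _ fun t _ => ?_
  rw [norm_mul, norm_pow, norm_norm]
  gcongr
  exact hm _

/-- Limit of the circulant bound: finitely many distinct sites are distinct mod `N` once `N` is
large. -/
theorem norm_quadratic_form_infCoeff_le (hm : ∀ x, |covSymbol β v x| ≤ m)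
    (hlim : ∀ k, Tendsto (fun N => finCoeff β v N k) atTop (𝓝 (infCoeff β v k)))
    {p : ι → ℤ} (hp : Function.Injective p) (x : ι → ℂ) :
    ‖star x ⬝ᵥ (Matrix.of (fun i j => infCoeff β v (p i - p j)) *ᵥ x)‖
      ≤ m * ∑ i, ‖x i‖ ^ 2 := by
  have ht : Tendsto (fun N => ‖star x ⬝ᵥ (Matrix.of (fun i j => finCoeff β v N (p i - p j)) *ᵥ x)‖)
      atTop (𝓝 ‖star x ⬝ᵥ (Matrix.of (fun i j => infCoeff β v (p i - p j)) *ᵥ x)‖) :=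
    (tendsto_finsetSum _ fun i _ => (tendsto_finsetSum _ fun j _ =>
      (hlim (p i - p j)).mul_const _).const_mul _).norm
  refine le_of_tendsto ht ?_
  have hev : ∀ᶠ N : ℕ in atTop, ∀ i j, (N : ℤ) ∣ p i - p j → i = j := by
    refine eventually_all.2 fun i => eventually_all.2 fun j => ?_
    filter_upwards [eventually_gt_atTop (p i - p j).natAbs] with N hN hd
    exact hp (sub_eq_zero.1 (Int.eq_zero_of_dvd_of_natAbs_lt_natAbs hd (by simpa using hN)))
  filter_upwards [hev, eventually_ne_atTop 0] with N hN hN0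
  exact norm_quadratic_form_finCoeff_le hm hN0 hN x

end QuadraticForm

theorem conj_finCoeff (β : ℝ) (v : ℕ → ℝ) (N : ℕ) (k : ℤ) :
    star (finCoeff β v N k) = finCoeff β v N (-k) := by
  change (starRingEnd ℂ) _ = _
  unfold finCoeff
  simp only [map_mul, map_sum, ← Complex.exp_conj, map_div₀, map_one, map_natCast,
    Complex.conj_ofReal, map_neg, Complex.conj_I, map_ofNat, map_intCast]
  push_cast
  simp only [mul_neg, neg_mul]

theorem tendsto_finCoeff {β : ℝ} {v : ℕ → ℝ} {κ : ℝ}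
    (hcont : Continuous (covSymbol β v)) (hκ : 0 < κ) (hext : ExtendsToStrip β v κ) (k : ℤ) :
    Tendsto (fun N => finCoeff β v N k) atTop (𝓝 (infCoeff β v k)) := by
  obtain ⟨C, -, hC⟩ := exists_norm_finCoeff_sub_infCoeff_le hcont hκ hext (half_pos hκ).le
    (half_lt_self hκ)
  rw [tendsto_iff_norm_sub_tendsto_zero]
  have h : Tendsto (fun N : ℕ => C * Real.exp (-(κ / 2 * (N - |(k : ℝ)|)))) atTop (𝓝 (C * 0)) := by
    refine (Real.tendsto_exp_neg_atTop_nhds_zero.comp ?_).const_mul C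
    exact (tendsto_atTop_add_const_right _ _ tendsto_natCast_atTop_atTop).const_mul_atTop
      (half_pos hκ)
  rw [mul_zero] at h
  refine squeeze_zero' (Eventually.of_forall fun _ => norm_nonneg _) ?_ h
  filter_upwards [eventually_ne_atTop 0] with N hN using hC N hN k

theorem conj_infCoeff {β : ℝ} {v : ℕ → ℝ}
    (hlim : ∀ k, Tendsto (fun N => finCoeff β v N k) atTop (𝓝 (infCoeff β v k))) (k : ℤ) :
    star (infCoeff β v k) = infCoeff β v (-k) := by
  refine tendsto_nhds_unique ((continuous_star.tendsto _).comp (hlim k)) ?_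
  simpa only [Function.comp_def, conj_finCoeff] using hlim (-k)

/-! ### The entropy function away from `±1`, and the decay rates. -/

theorem contDiffAt_entropyFun (α : ℝ) {x : ℝ} (h1 : -1 < x) (h2 : x < 1) :
    ContDiffAt ℝ 1 (entropyFun α) x := by
  have hp : 0 < (1 + x) / 2 := by linarith
  have hm : 0 < (1 - x) / 2 := by linarith
  have cp : ContDiffAt ℝ 1 (fun x : ℝ => (1 + x) / 2) x := by fun_prop
  have cm : ContDiffAt ℝ 1 (fun x : ℝ => (1 - x) / 2) x := by fun_prop
  unfold entropyFun
  split_ifs with hα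
  · simp only [Real.logb]
    exact (cp.neg.mul ((cp.log hp.ne').div_const _)).sub (cm.mul ((cm.log hm.ne').div_const _))
  · simp only [Real.logb]
    exact contDiffAt_const.mul ((((cp.rpow_const_of_ne hp.ne').add
      (cm.rpow_const_of_ne hm.ne')).log
        (add_pos (Real.rpow_pos_of_pos hp _) (Real.rpow_pos_of_pos hm _)).ne').div_const _)

theorem exists_lipschitzOnWith_entropyFun (α : ℝ) {m : ℝ} (hm : m < 1) :
    ∃ L : ℝ≥0, LipschitzOnWith L (entropyFun α) (Set.Icc (-m) m) := by
  have hc : ContDiffOn ℝ 1 (entropyFun α) (Set.Icc (-m) m) := fun x hx =>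
    (contDiffAt_entropyFun α (by linarith [hx.1]) (by linarith [hx.2])).contDiffWithinAt
  exact hc.exists_lipschitzOnWith one_ne_zero (convex_Icc _ _) isCompact_Icc

/-- On regions of diameter at most `(1 - ρ) N` the entropy error decays at every rate below `κρ`,
where `κ` is a width of analyticity of the symbol. -/
theorem decaysAtRate_entropyError {β : ℝ} {v : ℕ → ℝ} {r : ℕ} (hv : ∀ k, r < k → v k = 0)
    {κ : ℝ} (hκ : 0 < κ) (hext : ExtendsToStrip β v κ) (α : ℝ) {ρ : ℝ} (hρ : 0 < ρ)
    (S : ∀ N : ℕ, Finset (Fin N))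
    (hS : ∀ N, ∀ k ∈ S N, ∀ l ∈ S N, |((k : ℕ) : ℝ) - ((l : ℕ) : ℝ)| ≤ (1 - ρ) * N)
    {c : ℝ} (hc : c < κ * ρ) :
    DecaysAtRate (fun N => entropyError α β v N (S N)) c := by
  have hcont := continuous_covSymbol β hv
  obtain ⟨m, -, hm1, hm⟩ := exists_abs_covSymbol_le β hv
  obtain ⟨L, hL⟩ := exists_lipschitzOnWith_entropyFun α hm1
  have hlim := tendsto_finCoeff hcont hκ hext
  -- The rate `c` may be negative, whereas the coefficient estimate needs a nonnegative one; hence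
  -- the maximum with 0.
  obtain ⟨c', hc', hc'κ⟩ := exists_between (max_lt hκ ((div_lt_iff₀ hρ).2 hc))
  obtain ⟨h0c', hcc'⟩ := max_lt_iff.1 hc'
  rw [div_lt_iff₀ hρ] at hcc'
  obtain ⟨C, hC0, hC⟩ := exists_norm_finCoeff_sub_infCoeff_le hcont hκ hext h0c'.le hc'κ
  have hbound : ∀ N : ℕ, N ≠ 0 → entropyError α β v N (S N)
      ≤ L * (N : ℝ) ^ 4 * (C * Real.exp (-(c' * (ρ * N)))) := by
    intro N hN
    let p : S N → ℤ := fun i => ((i : Fin N) : ℕ)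
    have hpN : ∀ i j, (N : ℤ) ∣ p i - p j → i = j := by
      intro i j hd
      have hi := (i : Fin N).2
      have hj := (j : Fin N).2
      have h0 : p i - p j = 0 := Int.eq_zero_of_abs_lt_dvd hd (by
        rw [abs_lt]
        constructor <;> simp only [p] <;> omega)
      simp only [p] at h0
      exact Subtype.ext (Fin.ext (by omega))
    have hp : Function.Injective p := fun i j hij => hpN i j (by simp [hij])
    have hfH : (principal (finX β v N) (S N)).IsHermitian := Matrix.IsHermitian.ext fun i j => by
      change star (finCoeff β v N (p j - p i)) = finCoeff β v N (p i - p j)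
      rw [conj_finCoeff, neg_sub]
    have hiH : (principal (infX β v N) (S N)).IsHermitian := Matrix.IsHermitian.ext fun i j => by
      change star (infCoeff β v (p j - p i)) = infCoeff β v (p i - p j)
      rw [conj_infCoeff hlim, neg_sub]
    have hd : ∀ i j, ‖principal (finX β v N) (S N) i j - principal (infX β v N) (S N) i j‖
        ≤ C * Real.exp (-(c' * (ρ * N))) := by
      intro i j
      refine (hC N hN (p i - p j)).trans ?_
      have := hS N i i.2 j j.2
      gcongr
      simp only [p]
      push_cast
      linarith
    refine (hfH.norm_trace_cfc_sub_le hiH hd hL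
      (hfH.eigenvalues_mem_Icc_of_quadratic_form_le
        (norm_quadratic_form_finCoeff_le hm hN hpN))
      (hiH.eigenvalues_mem_Icc_of_quadratic_form_le
        (norm_quadratic_form_infCoeff_le hm hlim hp))).trans ?_
    have hcard : Fintype.card (S N) ≤ N := by
      simpa using Finset.card_le_univ (S N)
    gcongr
  -- The gap `c'ρ - c > 0` absorbs the polynomial factor.
  have hlim0 : Tendsto (fun N : ℕ => L * C * ((N : ℝ) ^ (4 : ℝ) *
      Real.exp (-(c' * ρ - c) * N))) atTop (𝓝 (L * C * 0)) :=
    ((tendsto_rpow_mul_exp_neg_mul_atTop_nhds_zero 4 _ (sub_pos.2 hcc')).comp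
      tendsto_natCast_atTop_atTop).const_mul _
  rw [mul_zero] at hlim0
  refine squeeze_zero' (Eventually.of_forall fun N => mul_nonneg (Real.exp_pos _).le
    (norm_nonneg _)) ?_ hlim0
  filter_upwards [eventually_ne_atTop 0] with N hN
  calc _ ≤ Real.exp (N * c) * (L * (N : ℝ) ^ 4 * (C * Real.exp (-(c' * (ρ * N))))) := by
        gcongr
        exact hbound N hN
    _ = L * C * ((N : ℝ) ^ 4 * (Real.exp (N * c) * Real.exp (-(c' * (ρ * N))))) := by ring
    _ = _ := by
      rw [← Real.exp_add]
      norm_cast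
      congr 4
      ring

theorem abs_sub_le_of_mem_regionA {q : ℝ} {N : ℕ} {k l : Fin N} (hk : k ∈ regionA q N)
    (hl : l ∈ regionA q N) : |((k : ℕ) : ℝ) - ((l : ℕ) : ℝ)| ≤ q * N := by
  simp only [regionA, Finset.mem_filter, Finset.mem_univ, true_and, Nat.lt_ceil] at hk hl
  have := (k : ℕ).cast_nonneg (α := ℝ)
  have := (l : ℕ).cast_nonneg (α := ℝ)
  rw [abs_le]
  constructor <;> linarith

theorem abs_sub_le_of_mem_regionB {q : ℝ} {N : ℕ} {k l : Fin N} (hk : k ∈ regionB q N)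
    (hl : l ∈ regionB q N) : |((k : ℕ) : ℝ) - ((l : ℕ) : ℝ)| ≤ (1 - q) * N := by
  simp only [regionB, Finset.mem_filter, Finset.mem_univ, true_and, Nat.ceil_le] at hk hl
  have : ((k : ℕ) : ℝ) ≤ N := Nat.cast_le.2 k.2.le
  have : ((l : ℕ) : ℝ) ≤ N := Nat.cast_le.2 l.2.le
  rw [abs_le]
  constructor <;> linarith

theorem lemma1 (r : ℕ) (v : ℕ → ℝ) (hv : ∀ k, r < k → v k = 0)
    (β : ℝ) (hβ : 0 < β) (q : ℝ) (hq0 : 0 < q) (hq1 : q < 1) :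
    (∃ a b : ℝ, 0 < a ∧ 0 < b ∧ ∀ α : ℝ, 0 ≤ α →
      DecaysAtRate (fun N => entropyError α β v N (regionA q N)) a ∧
      DecaysAtRate (fun N => entropyError α β v N (regionB q N)) b) ∧
    (∃ κ : ℝ, 0 < κ ∧ ExtendsToStrip β v κ) ∧
    (∀ κ : ℝ, 0 < κ → ExtendsToStrip β v κ → ∀ α : ℝ, 0 ≤ α →
      (∀ γ : ℝ≥0, 0 < γ → γ ≤ 1 →
        (∃ C : ℝ≥0, HolderOnWith C γ (entropyFun α) (Set.Icc (-1) 1)) →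
        (∀ c : ℝ, c < γ * κ * (1 - q) →
          DecaysAtRate (fun N => entropyError α β v N (regionA q N)) c) ∧
        (∀ c : ℝ, c < γ * κ * q →
          DecaysAtRate (fun N => entropyError α β v N (regionB q N)) c)) ∧
      (∀ c : ℝ, c < min α 1 * κ * (1 - q) →
        DecaysAtRate (fun N => entropyError α β v N (regionA q N)) c) ∧
      (∀ c : ℝ, c < min α 1 * κ * q →
        DecaysAtRate (fun N => entropyError α β v N (regionB q N)) c)) := by

  have hA : ∀ κ : ℝ, 0 < κ → ExtendsToStrip β v κ → ∀ α c : ℝ, c < κ * (1 - q) →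
      DecaysAtRate (fun N => entropyError α β v N (regionA q N)) c :=
    fun κ hκ hext α c hc => decaysAtRate_entropyError hv hκ hext α (sub_pos.2 hq1) _
      (fun N k hk l hl => by simpa using abs_sub_le_of_mem_regionA hk hl) hc
  have hB : ∀ κ : ℝ, 0 < κ → ExtendsToStrip β v κ → ∀ α c : ℝ, c < κ * q →
      DecaysAtRate (fun N => entropyError α β v N (regionB q N)) c :=
    fun κ hκ hext α c hc => decaysAtRate_entropyError hv hκ hext α hq0 _
      (fun N k hk l hl => abs_sub_le_of_mem_regionB hk hl) hc
  -- Both `γ` and `min α 1` are at most 1, so all rates of the third claim lie below `κρ`.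
  have hscale : ∀ γ κ ρ c : ℝ, γ ≤ 1 → 0 < κ → 0 < ρ → c < γ * κ * ρ → c < κ * ρ :=
    fun γ κ ρ c hγ hκ hρ hc => hc.trans_le (by
      rw [mul_assoc]
      exact mul_le_of_le_one_left (mul_pos hκ hρ).le hγ)
  have hq' : 0 < 1 - q := sub_pos.2 hq1
  obtain ⟨κ₀, hκ₀, hext₀⟩ := exists_extendsToStrip hβ hv
  -- Half the critical rate; `κ₀` is fixed before `α`, so the constants are uniform in `α`.
  refine ⟨⟨κ₀ * (1 - q) / 2, κ₀ * q / 2, by positivity, by positivity, fun α _ =>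
    ⟨hA κ₀ hκ₀ hext₀ α _ (half_lt_self (by positivity)),
      hB κ₀ hκ₀ hext₀ α _ (half_lt_self (by positivity))⟩⟩, ⟨κ₀, hκ₀, hext₀⟩, ?_⟩
  intro κ hκ hext α _
  refine ⟨fun γ _ hγ _ => ⟨fun c hc => hA κ hκ hext α c (hscale γ κ _ c hγ hκ hq' hc),
    fun c hc => hB κ hκ hext α c (hscale γ κ _ c hγ hκ hq0 hc)⟩,
    fun c hc => hA κ hκ hext α c (hscale _ κ _ c (min_le_right _ _) hκ hq' hc),
    fun c hc => hB κ hκ hext α c (hscale _ κ _ c (min_le_right _ _) hκ hq0 hc)⟩
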